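/- For $\beta\ge 0$ let $E_{2,\beta}(z)=\sum_{k\ge 0} \frac{z^k}{\Gamma(2k+\beta)}$, $z\in\mathbb{C}$, be the two-parameter Mittag-Leffler function with $\alpha=2$ (where $1/\Gamma(0)=0$). It is real-valued on $\mathbb{R}$. We say that the inequality $(\ge)$ holds globally for $E_{2,\beta}$ if $|E_{2,\beta}(z)|\ge E_{2,\beta}(\operatorname{Re} z)$ for all $z\in\mathbb{C}$. (a) If $\beta\ge 4$, then $E_{2,\beta}(x)>0$ for every $x\in\mathbb{R}$. The function $E_{2,\beta}$ has zeros in $\mathbb{C}$, all of them are non-real, and $(\ge)$ does not hold globally. (b) If $3<\beta<4$, then $E_{2,\beta}$ has only finitely many (possibly no) negative zeros, and $(\ge)$ does not hold globally. (c) For every $\beta\ge 0$, the inequality $(\ge)$ holds globally for $E_{2,\beta}$ if and only if $\beta\le 3$. -/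

import Mathlib

/-- The two-parameter Mittag-Leffler function `E_{α,β}(z) = ∑ z ^ k / Γ(α k + β)` on `ℂ`.
At the poles of `Γ`, Mathlib's `Γ` is `0`, so the term is `0`, which is the usual convention
`1 / Γ = 0`. -/
noncomputable def mittagLeffler (α β : ℝ) (z : ℂ) : ℂ :=
  ∑' k : ℕ, z ^ k / (Real.Gamma (α * k + β) : ℂ)

/-- The same series on the real line, as a real-valued function. -/
noncomputable def mittagLefflerReal (α β x : ℝ) : ℝ :=
  ∑' k : ℕ, x ^ k / Real.Gamma (α * k + β)

/-- The real function is the restriction of the complex one to the real line. -/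
theorem mittagLeffler_ofReal (α β x : ℝ) :
    mittagLeffler α β (x : ℂ) = (mittagLefflerReal α β x : ℂ) := by
  unfold mittagLeffler mittagLefflerReal
  rw [Complex.ofReal_tsum]
  push_cast
  rfl

/-- The inequality `|E_{α,β}(z)| ≥ E_{α,β}(Re z)` holds globally, that is, for every complex `z`. -/
def MittagLefflerGlobalGE (α β : ℝ) : Prop :=
  ∀ z : ℂ, ‖mittagLeffler α β z‖ ≥ mittagLefflerReal α β z.re

/-! Write `E_β` for `E_{2,β}`. The threshold 3 separates two mechanisms.

For `β ≤ 3`, `E_β` is a pointwise limit of polynomials with only real roots. For such a polynomial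
each linear factor shrinks when `z` is replaced by `Re z`, and the resulting inequality passes to
the limit. For `2 ≤ β ≤ 3` the approximants are rescaled coefficients in `t` of `(1 - t)^(2 - β) /
((1 - t)^2 - z t)`. The substitution `z = w + w⁻¹ - 2` turns a root into an equation `A(w) =
A(w⁻¹)`, where `A` has real monotone coefficients. By Eneström–Kakeya the roots of `A` lie in the
closed unit disc, so the equation forces `|w| = 1` and `z` is real. Smaller `β` follow from `(2 z
d/dz + β) E_{β+1} = E_β`, since this operator, applied to a polynomial with negative roots, keeps
the roots real.

For `β > 3`, `Γ(β-3) x² E_β(-x²) = ∫₀¹ (1 - cos xt) (1 - t)^(β-4) dt > 0`, so `E_β` is positive on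
the whole real line. It is nonconstant of growth at most `exp √|z|`, hence has a zero `z`, and there
`|E_β(z)| = 0 < E_β(Re z)`. -/

section RealRooted

open Polynomial Finset ComplexConjugate

/-! ### Polynomials with only real roots -/

/-- A complex polynomial whose roots are all real grows away from the real axis. -/
theorem norm_eval_re_le_norm_eval {P : ℂ[X]} (hP : ∀ z, P.eval z = 0 → z.im = 0) (z : ℂ) :
    ‖P.eval (z.re : ℂ)‖ ≤ ‖P.eval z‖ := by
  have hs := IsAlgClosed.splits P
  rw [hs.eval_eq_prod_roots, hs.eval_eq_prod_roots, norm_mul, norm_mul]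
  refine mul_le_mul_of_nonneg_left ?_ (norm_nonneg _)
  have hr : ∀ x ∈ P.roots, x.im = 0 := fun x hx => hP x (isRoot_of_mem_roots hx)
  generalize P.roots = s at hr
  induction s using Multiset.induction_on with
  | empty => simp
  | cons a s ih =>
    simp only [Multiset.map_cons, Multiset.prod_cons, norm_mul]
    refine mul_le_mul ?_ (ih fun x hx => hr x (Multiset.mem_cons_of_mem hx)) (norm_nonneg _)
      (norm_nonneg _)
    have ha : a.im = 0 := hr a (Multiset.mem_cons_self a s)
    rw [Complex.norm_def, Complex.norm_def]
    refine Real.sqrt_le_sqrt ?_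
    simp only [Complex.normSq_apply, Complex.sub_re, Complex.sub_im, Complex.ofReal_re,
      Complex.ofReal_im, ha]
    nlinarith [mul_self_nonneg z.im]

/-- If all roots of `P` are negative reals, then all roots of `2 z P' + a P` are real. -/
theorem im_eq_zero_of_eval_two_mul_derivative_add {P : ℂ[X]} (hd : P.natDegree ≠ 0)
    (hP : ∀ z, P.eval z = 0 → z.im = 0 ∧ z.re < 0) (a : ℝ) {z : ℂ}
    (hz : 2 * z * P.derivative.eval z + a * P.eval z = 0) : z.im = 0 := by
  by_contra him
  have hPz : P.eval z ≠ 0 := fun h => him (hP z h).1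
  have hs := IsAlgClosed.splits P
  have h1 := hs.eval_derivative_div_eval_of_ne_zero hPz
  -- Divide by `P(z)`: as `a` is real, `z P'(z) / P(z)` is real as well.
  have h2 : 2 * (z * (P.derivative.eval z / P.eval z)) + a = 0 := by
    field_simp
    linear_combination hz
  have h3 : (z * (P.derivative.eval z / P.eval z)).im = 0 := by
    have := congrArg Complex.im h2
    simpa using this
  rw [h1] at h3
  have hr : ∀ x ∈ P.roots, x.im = 0 ∧ x.re < 0 := fun x hx => hP x (isRoot_of_mem_roots hx)
  have hne : P.roots ≠ 0 := by
    intro h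
    have := hs.natDegree_eq_card_roots
    rw [h] at this
    exact hd (by simpa using this)
  -- For real `x < 0`, `Im (z / (z - x)) = (-x / |z - x|²) Im z`, so all roots contribute with the
  -- same sign and nothing cancels.
  have key : ∀ s : Multiset ℂ, (∀ x ∈ s, x.im = 0 ∧ x.re < 0) → ∃ c : ℝ, 0 ≤ c ∧
      (s ≠ 0 → 0 < c) ∧ (z * (s.map fun x => 1 / (z - x)).sum).im = c * z.im := by
    intro s
    induction s using Multiset.induction_on with
    | empty => exact fun _ => ⟨0, le_rfl, fun h => absurd rfl h, by simp⟩
    | cons x s ih =>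
      intro hs
      obtain ⟨c, hc, -, hc'⟩ := ih fun y hy => hs y (Multiset.mem_cons_of_mem hy)
      obtain ⟨hx1, hx2⟩ := hs x (Multiset.mem_cons_self x s)
      have hzx : z - x ≠ 0 := by
        intro h
        rw [sub_eq_zero.mp h] at him
        exact him hx1
      have hpos : 0 < Complex.normSq (z - x) := Complex.normSq_pos.mpr hzx
      have hq : 0 < -x.re / Complex.normSq (z - x) := div_pos (by linarith) hpos
      refine ⟨-x.re / Complex.normSq (z - x) + c, by linarith, fun _ => by linarith, ?_⟩
      rw [Multiset.map_cons, Multiset.sum_cons, mul_add, Complex.add_im, hc', add_mul]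
      congr 1
      simp only [one_div, Complex.mul_im, Complex.inv_re, Complex.inv_im, Complex.sub_re,
        Complex.sub_im, hx1]
      field_simp
      ring
  obtain ⟨c, -, hc, hc'⟩ := key _ hr
  rw [hc'] at h3
  exact (mul_ne_zero (hc hne).ne' him) h3

/-! ### A polynomial with monotone coefficients off the unit circle -/

/-- Abel summation: the expression inside the norm is `-∑ (a_m - a_{m+1}) v^(m+1)` over `m < N`. The
decrements are nonnegative and telescope. -/
theorem norm_one_sub_mul_sum_sub_le {a : ℕ → ℝ} (ha : Antitone a)
    {v : ℂ} (hv : ‖v‖ ≤ 1) (N : ℕ) :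
    ‖(1 - v) * ∑ m ∈ range (N + 1), (a m : ℂ) * v ^ m + a N * v ^ (N + 1) - a 0‖
      ≤ (a 0 - a N) * ‖v‖ := by
  induction N with
  | zero =>
    simp
    ring_nf
  | succ N ih =>
    have e : (1 - v) * ∑ m ∈ range (N + 1 + 1), (a m : ℂ) * v ^ m
        + a (N + 1) * v ^ (N + 1 + 1) - a 0
        = ((1 - v) * ∑ m ∈ range (N + 1), (a m : ℂ) * v ^ m + a N * v ^ (N + 1) - a 0)
          - ((a N - a (N + 1) : ℝ) : ℂ) * v ^ (N + 1) := by
      rw [sum_range_succ _ (N + 1)]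
      push_cast
      ring
    rw [e]
    refine (norm_sub_le _ _).trans ?_
    have h1 : ‖((a N - a (N + 1) : ℝ) : ℂ) * v ^ (N + 1)‖ ≤ (a N - a (N + 1)) * ‖v‖ := by
      have h0 : 0 ≤ a N - a (N + 1) := sub_nonneg.mpr (ha (Nat.le_succ N))
      rw [norm_mul, Complex.norm_real, Real.norm_of_nonneg h0, norm_pow, pow_succ]
      have : ‖v‖ ^ N * ‖v‖ ≤ 1 * ‖v‖ :=
        mul_le_mul_of_nonneg_right (pow_le_one₀ (norm_nonneg v) hv) (norm_nonneg v)
      rw [one_mul] at this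
      exact mul_le_mul_of_nonneg_left this h0
    linarith

/-- **Eneström–Kakeya**: the zeros of `∑ aₘ vᵐ` with `a` nonnegative and antitone lie outside
the open unit disc. -/
theorem sum_antitone_mul_pow_ne_zero {a : ℕ → ℝ} (ha : Antitone a) (h0 : ∀ m, 0 ≤ a m)
    (hpos : 0 < a 0) {v : ℂ} (hv : ‖v‖ < 1) (N : ℕ) :
    ∑ m ∈ range (N + 1), (a m : ℂ) * v ^ m ≠ 0 := by
  intro h
  have h1 := norm_one_sub_mul_sum_sub_le ha hv.le N
  rw [h, mul_zero, zero_add] at h1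
  have h2 : ‖(a 0 : ℂ)‖ - ‖(a N : ℂ) * v ^ (N + 1)‖ ≤ ‖(a N : ℂ) * v ^ (N + 1) - a 0‖ := by
    rw [norm_sub_rev]
    exact norm_sub_norm_le _ _
  have h3 : ‖(a N : ℂ) * v ^ (N + 1)‖ ≤ a N * ‖v‖ := by
    rw [norm_mul, Complex.norm_real, Real.norm_of_nonneg (h0 N), norm_pow, pow_succ]
    have : ‖v‖ ^ N * ‖v‖ ≤ 1 * ‖v‖ :=
      mul_le_mul_of_nonneg_right (pow_le_one₀ (norm_nonneg v) hv.le) (norm_nonneg v)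
    rw [one_mul] at this
    exact mul_le_mul_of_nonneg_left this (h0 N)
  rw [Complex.norm_real, Real.norm_of_nonneg hpos.le] at h2
  nlinarith

/-- The polynomial `∑ a_{N-k} X ^ (k + 1)`, in Horner form. -/
noncomputable def hornerPoly (a : ℕ → ℝ) : ℕ → ℂ[X]
  | 0 => X * C (a 0 : ℂ)
  | N + 1 => X * (hornerPoly a N + C (a (N + 1) : ℂ))

theorem hornerPoly_eval_eq (a : ℕ → ℝ) {w : ℂ} (hw : w ≠ 0) (N : ℕ) :
    (hornerPoly a N).eval w = w ^ (N + 1) * ∑ m ∈ range (N + 1), (a m : ℂ) * w⁻¹ ^ m := by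
  induction N with
  | zero => simp [hornerPoly, mul_comm w]
  | succ N ih =>
    have h : w ^ (N + 1 + 1) * ((a (N + 1) : ℂ) * w⁻¹ ^ (N + 1)) = w * a (N + 1) := by
      rw [inv_pow, pow_succ]
      field_simp
    rw [sum_range_succ, mul_add, h, pow_succ w (N + 1)]
    simp only [hornerPoly, eval_mul, eval_X, eval_add, eval_C, ih]
    ring

theorem hornerPoly_eval_conj (a : ℕ → ℝ) (w : ℂ) (N : ℕ) :
    (hornerPoly a N).eval (conj w) = conj ((hornerPoly a N).eval w) := by
  induction N with
  | zero => simp [hornerPoly]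
  | succ N ih => simp [hornerPoly, ih]

/-- The difference of the squared norms is `(|w|² - 1)(1 - |x|²)`. -/
theorem norm_one_sub_conj_mul_le {w x : ℂ} (hw : 1 ≤ ‖w‖) (hx : ‖x‖ ≤ 1) :
    ‖1 - conj w * x‖ ≤ ‖w - x‖ := by
  have h1 : 1 ≤ Complex.normSq w := by
    rw [← Complex.sq_norm]; nlinarith
  have h2 : Complex.normSq x ≤ 1 := by
    rw [← Complex.sq_norm]; nlinarith [norm_nonneg x]
  rw [Complex.norm_def, Complex.norm_def]
  refine Real.sqrt_le_sqrt ?_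
  simp only [Complex.normSq_apply, Complex.sub_re, Complex.sub_im, Complex.mul_re, Complex.mul_im,
    Complex.conj_re, Complex.conj_im, Complex.one_re, Complex.one_im] at *
  nlinarith [mul_nonneg (sub_nonneg.mpr h1) (sub_nonneg.mpr h2)]

/-- If all roots of `P` lie in the closed unit disc, then off the disc `P` dominates its
conjugate reciprocal. -/
theorem norm_pow_mul_eval_inv_conj_le {P : ℂ[X]} (hP : ∀ x, P.eval x = 0 → ‖x‖ ≤ 1) {w : ℂ}
    (hw : 1 ≤ ‖w‖) : ‖w‖ ^ P.natDegree * ‖P.eval (conj w)⁻¹‖ ≤ ‖P.eval w‖ := by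
  have hs := IsAlgClosed.splits P
  have hw0 : conj w ≠ 0 := by
    rw [Ne, map_eq_zero, ← norm_eq_zero]; linarith
  rw [hs.eval_eq_prod_roots, hs.eval_eq_prod_roots, norm_mul, norm_mul,
    hs.natDegree_eq_card_roots, mul_left_comm]
  refine mul_le_mul_of_nonneg_left ?_ (norm_nonneg _)
  have hr : ∀ x ∈ P.roots, ‖x‖ ≤ 1 := fun x hx => hP x (isRoot_of_mem_roots hx)
  generalize P.roots = s at hr
  induction s using Multiset.induction_on with
  | empty => simp
  | cons a s ih =>
    simp only [Multiset.map_cons, Multiset.prod_cons, norm_mul, Multiset.card_cons, pow_succ]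
    have h1 := ih fun x hx => hr x (Multiset.mem_cons_of_mem hx)
    have h2 : ‖w‖ * ‖(conj w)⁻¹ - a‖ ≤ ‖w - a‖ := by
      refine le_trans (le_of_eq ?_) (norm_one_sub_conj_mul_le hw (hr a (Multiset.mem_cons_self a s)))
      rw [← Complex.norm_conj w, ← norm_mul, mul_sub, mul_inv_cancel₀ hw0]
    calc _ = (‖w‖ * ‖(conj w)⁻¹ - a‖) * (‖w‖ ^ s.card *
          ‖(Multiset.map (fun x => (conj w)⁻¹ - x) s).prod‖) := by ring
      _ ≤ _ := mul_le_mul h2 h1 (by positivity) (norm_nonneg _)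

theorem hornerPoly_natDegree (a : ℕ → ℝ) (ha : a 0 ≠ 0) (N : ℕ) :
    (hornerPoly a N).natDegree = N + 1 := by
  induction N with
  | zero => simp [hornerPoly, ha]
  | succ N ih =>
    have h : (hornerPoly a N + C (a (N + 1) : ℂ)).natDegree = N + 1 := by
      rw [natDegree_add_C, ih]
    rw [hornerPoly, natDegree_X_mul, h]
    intro h0
    rw [h0] at h
    simp at h

/-- The coefficients are real, so domination of the conjugate reciprocal reads `|w|^(N+1) |A(w⁻¹)| ≤
|A(w)|`. Equality of the two values would then force `A(w) = 0`, which Eneström–Kakeya excludes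
outside the closed disc. -/
theorem hornerPoly_eval_ne_eval_inv {a : ℕ → ℝ} (ha : Antitone a) (h0 : ∀ m, 0 ≤ a m)
    (hpos : 0 < a 0) {w : ℂ} (hw : 1 < ‖w‖) (N : ℕ) :
    (hornerPoly a N).eval w ≠ (hornerPoly a N).eval w⁻¹ := by
  have hroot : ∀ x : ℂ, 1 < ‖x‖ → (hornerPoly a N).eval x ≠ 0 := by
    intro x hx
    have hx0 : x ≠ 0 := norm_pos_iff.mp (by linarith)
    rw [hornerPoly_eval_eq a hx0]
    refine mul_ne_zero (pow_ne_zero _ hx0) (sum_antitone_mul_pow_ne_zero ha h0 hpos ?_ N)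
    rw [norm_inv]
    exact inv_lt_one_of_one_lt₀ hx
  intro h
  have h1 := norm_pow_mul_eval_inv_conj_le (P := hornerPoly a N)
    (fun x hx => not_lt.mp fun hlt => hroot x hlt hx) hw.le
  rw [hornerPoly_natDegree a hpos.ne', ← map_inv₀, hornerPoly_eval_conj, Complex.norm_conj, ← h]
    at h1
  have h2 : 0 < ‖(hornerPoly a N).eval w‖ := norm_pos_iff.mpr (hroot w hw)
  have h3 : 1 < ‖w‖ ^ (N + 1) := one_lt_pow₀ hw (Nat.succ_ne_zero N)
  nlinarith

end RealRooted

section Approximation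

open Polynomial Finset ComplexConjugate Filter Topology

/-! ### Binomial coefficients of `(1 - w) ^ (-r)` -/

/-- The coefficient of `w ^ m` in `(1 - w) ^ (-r)`. -/
noncomputable def risingCoeff (r : ℝ) (m : ℕ) : ℝ := ∏ i ∈ range m, (r + i) / (i + 1)

@[simp] theorem risingCoeff_zero (r : ℝ) : risingCoeff r 0 = 1 := by simp [risingCoeff]

theorem risingCoeff_succ (r : ℝ) (m : ℕ) :
    risingCoeff r (m + 1) = risingCoeff r m * ((r + m) / (m + 1)) := by
  rw [risingCoeff, prod_range_succ, risingCoeff]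

theorem risingCoeff_one (r : ℝ) : risingCoeff r 1 = r := by simp [risingCoeff]

theorem risingCoeff_succ_mul (r : ℝ) (m : ℕ) :
    risingCoeff r (m + 1) * (m + 1) = r * risingCoeff (r + 1) m := by
  induction m with
  | zero => simp [risingCoeff_one]
  | succ m ih =>
    rw [risingCoeff_succ r (m + 1), risingCoeff_succ (r + 1) m, ← mul_assoc r, ← ih]
    push_cast
    field_simp
    ring

theorem risingCoeff_pascal (r : ℝ) (m : ℕ) :
    risingCoeff (r + 1) (m + 1) = risingCoeff (r + 1) m + risingCoeff r (m + 1) := by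
  have h := risingCoeff_succ_mul r m
  rw [risingCoeff_succ (r + 1) m]
  have hm : (m : ℝ) + 1 ≠ 0 := by positivity
  field_simp
  linear_combination -h

/-- Coefficients in `(1 - w)^2 (1 - w)^(-(r+2)) = (1 - w)^(-r)`. This is what makes the recurrence
of `risingPoly` match its explicit coefficients. -/
theorem risingCoeff_second_difference (r : ℝ) (m : ℕ) :
    risingCoeff (r + 2) (m + 2) - 2 * risingCoeff (r + 2) (m + 1) + risingCoeff (r + 2) m
      = risingCoeff r (m + 2) := by
  have h1 := risingCoeff_pascal (r + 1) (m + 1)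
  have h2 := risingCoeff_pascal (r + 1) m
  have h3 := risingCoeff_pascal r (m + 1)
  rw [show r + 1 + 1 = r + 2 by ring] at h1 h2
  linarith

theorem risingCoeff_nonneg {r : ℝ} (hr : 0 ≤ r) (m : ℕ) : 0 ≤ risingCoeff r m :=
  prod_nonneg fun _ _ => by positivity

theorem risingCoeff_antitone {r : ℝ} (hr : 0 ≤ r) (hr1 : r ≤ 1) : Antitone (risingCoeff r) := by
  refine antitone_nat_of_succ_le fun m => ?_
  rw [risingCoeff_succ]
  refine mul_le_of_le_one_right (risingCoeff_nonneg hr m) ?_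
  rw [div_le_one (by positivity)]
  linarith

theorem prod_add_mul_Gamma {r : ℝ} (hr : 0 < r) (m : ℕ) :
    (∏ i ∈ range m, (r + i)) * Real.Gamma r = Real.Gamma (r + m) := by
  induction m with
  | zero => simp
  | succ m ih =>
    have h : Real.Gamma (r + m + 1) = (r + m) * Real.Gamma (r + m) :=
      Real.Gamma_add_one (by positivity)
    rw [prod_range_succ, mul_right_comm, ih, Nat.cast_succ, ← add_assoc, h, mul_comm]

theorem risingCoeff_mul_Gamma {r : ℝ} (hr : 0 < r) (m : ℕ) :
    risingCoeff r m * m.factorial * Real.Gamma r = Real.Gamma (r + m) := by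
  rw [← prod_add_mul_Gamma hr]
  congr 1
  induction m with
  | zero => simp
  | succ m ih =>
    rw [risingCoeff_succ, prod_range_succ, ← ih, Nat.factorial_succ]
    push_cast
    field_simp

theorem prod_sub_mul_factorial {N j : ℕ} (h : j ≤ N) :
    (∏ i ∈ range j, ((N : ℝ) - i)) * (N - j).factorial = N.factorial := by
  induction j with
  | zero => simp
  | succ j ih =>
    rw [← ih (by omega), prod_range_succ, mul_assoc]
    congr 1
    rw [show N - j = (N - (j + 1)) + 1 by omega, Nat.factorial_succ]
    have : ((N - (j + 1) : ℕ) : ℝ) + 1 = N - j := by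
      rw [Nat.cast_sub h]; push_cast; ring
    push_cast
    rw [this]

/-! ### Real-rooted polynomials with coefficients `risingCoeff (2 j + b) (N - j)` -/

/-- The polynomials with generating function
`∑ q_N(z) t ^ N = (1 - t) ^ (2 - b) / ((1 - t) ^ 2 - z t)`. -/
noncomputable def risingPoly (b : ℝ) : ℕ → ℂ[X]
  | 0 => 1
  | 1 => X + C (b : ℂ)
  | N + 2 => (X + C 2) * risingPoly b (N + 1) - risingPoly b N + C (risingCoeff (b - 2) (N + 2) : ℂ)

/-- The generating function expands geometrically as `∑ z^j t^j (1 - t)^(-(2j+b))`. -/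
theorem risingPoly_coeff (b : ℝ) (N j : ℕ) :
    (risingPoly b N).coeff j = if j ≤ N then (risingCoeff (2 * j + b) (N - j) : ℂ) else 0 := by
  induction N using Nat.twoStepInduction generalizing j with
  | zero =>
    rcases j with _ | j <;> simp [risingPoly, coeff_one]
  | one =>
    rcases j with _ | _ | j
    · simp [risingPoly, risingCoeff_one]
    · simp [risingPoly]
    · simp [risingPoly, coeff_X]
  | more N ih1 ih2 =>
    rw [risingPoly, coeff_add, coeff_sub, add_mul, coeff_add, coeff_C_mul, ih2, ih1]
    rcases j with _ | j
    · simp only [coeff_X_mul_zero, coeff_C_zero]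
      have h := risingCoeff_second_difference (b - 2) N
      rw [sub_add_cancel] at h
      simp only [zero_le, if_true, Nat.sub_zero, Nat.cast_zero, mul_zero, zero_add, ← h]
      push_cast
      ring
    · rw [coeff_X_mul, ih2, coeff_C_succ]
      rcases lt_trichotomy j N with h | h | h
      · obtain ⟨m, rfl⟩ : ∃ m, N = j + 1 + m := ⟨N - (j + 1), by omega⟩
        have h := risingCoeff_second_difference (2 * j + b) m
        rw [if_pos (by omega), if_pos (by omega), if_pos (by omega), if_pos (by omega),
          show j + 1 + m + 1 - j = m + 2 by omega, show j + 1 + m + 1 - (j + 1) = m + 1 by omega,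
          show j + 1 + m - (j + 1) = m by omega, show j + 1 + m + 2 - (j + 1) = m + 2 by omega, ← h,
          show (2 * ((j + 1 : ℕ) : ℝ) + b) = 2 * j + b + 2 by push_cast; ring]
        push_cast
        ring
      · subst h
        rw [if_pos (by omega), if_pos (by omega), if_neg (by omega), if_pos (by omega),
          show j + 1 - j = 1 by omega, show j + 1 - (j + 1) = 0 by omega,
          show j + 2 - (j + 1) = 1 by omega, risingCoeff_one, risingCoeff_one, risingCoeff_zero]
        push_cast
        ring
      · rw [if_neg (show ¬ j + 1 ≤ N + 1 by omega), if_neg (show ¬ j + 1 ≤ N by omega)]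
        rcases eq_or_ne j (N + 1) with h | h
        · subst h; simp
        · rw [if_neg (by omega), if_neg (by omega)]; simp

/-- At `z = w + w⁻¹ - 2` the denominator `(1 - t)^2 - z t` factors as `(1 - w t)(1 - w⁻¹ t)`. The
identity is the resulting partial fraction decomposition, multiplied by `(1 - t)^(2 - b)`. -/
theorem risingPoly_eval_add_inv (b : ℝ) {w : ℂ} (hw : w ≠ 0) (N : ℕ) :
    (w - w⁻¹) * (risingPoly b N).eval (w + w⁻¹ - 2)
      = (hornerPoly (risingCoeff (b - 2)) N).eval w
        - (hornerPoly (risingCoeff (b - 2)) N).eval w⁻¹ := by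
  induction N using Nat.twoStepInduction with
  | zero => simp [risingPoly, hornerPoly]
  | one =>
    simp [risingPoly, hornerPoly, risingCoeff_one]
    field_simp
    ring
  | more N ih1 ih2 =>
    have e : (w - w⁻¹) * (risingPoly b (N + 2)).eval (w + w⁻¹ - 2)
        = (w + w⁻¹) * ((w - w⁻¹) * (risingPoly b (N + 1)).eval (w + w⁻¹ - 2))
          - (w - w⁻¹) * (risingPoly b N).eval (w + w⁻¹ - 2)
          + (w - w⁻¹) * risingCoeff (b - 2) (N + 2) := by
      simp only [risingPoly, eval_add, eval_sub, eval_mul, eval_X, eval_C]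
      ring
    rw [e, ih1, ih2]
    simp only [hornerPoly, eval_add, eval_mul, eval_X, eval_C]
    field_simp
    ring

theorem risingPoly_im_eq_zero {b : ℝ} (h2 : 2 ≤ b) (h3 : b ≤ 3) (N : ℕ) {z : ℂ}
    (hz : (risingPoly b N).eval z = 0) : z.im = 0 := by
  -- Solve `w + w⁻¹ = z + 2` by the quadratic formula; `d` is a square root of the discriminant.
  obtain ⟨d, hd⟩ := IsAlgClosed.exists_pow_nat_eq ((z + 2) ^ 2 - 4) (n := 2) two_pos
  set w : ℂ := (z + 2 + d) / 2 with hw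
  have hww : w * ((z + 2 - d) / 2) = 1 := by rw [hw]; linear_combination -hd / 4
  have hinv : w⁻¹ = (z + 2 - d) / 2 := inv_eq_of_mul_eq_one_right hww
  have hw0 : w ≠ 0 := left_ne_zero_of_mul_eq_one hww
  have hzw : z = w + w⁻¹ - 2 := by rw [hinv, hw]; ring
  have hE := risingPoly_eval_add_inv b hw0 N
  rw [← hzw, hz, mul_zero] at hE
  have hne : ∀ v : ℂ, 1 < ‖v‖ → _ ≠ _ := fun v hv =>
    hornerPoly_eval_ne_eval_inv
    (risingCoeff_antitone (r := b - 2) (by linarith) (by linarith))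
    (risingCoeff_nonneg (by linarith)) (by simp) hv N
  rcases lt_trichotomy ‖w‖ 1 with h | h | h
  · refine absurd ?_ (hne w⁻¹ ?_)
    · rw [inv_inv]; exact (sub_eq_zero.mp hE.symm).symm
    · rw [norm_inv]; exact (one_lt_inv₀ (norm_pos_iff.mpr hw0)).mpr h
  · rw [hzw, Complex.inv_eq_conj h]
    simp
  · exact absurd (sub_eq_zero.mp hE.symm) (hne w h)

/-! ### Polynomial approximations of the Mittag-Leffler function -/

/-- Weights tending to `1` as `N → ∞`. -/
noncomputable def mlWeight (b : ℝ) (N j : ℕ) : ℝ :=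
  ∏ i ∈ range j, ((N + b + i) * (N - i) / (N : ℝ) ^ 2)

/-- Polynomials tending to `E_{2,β}`. -/
noncomputable def mlPoly (b β : ℝ) (N : ℕ) : ℂ[X] :=
  ∑ j ∈ range (N + 1), monomial j ((mlWeight b N j / Real.Gamma (2 * j + β) : ℝ) : ℂ)

theorem mlWeight_eq_zero (b : ℝ) {N j : ℕ} (h : N < j) : mlWeight b N j = 0 :=
  prod_eq_zero (mem_range.mpr h) (by simp)

theorem mlWeight_nonneg {b : ℝ} (hb : 0 ≤ b) (N j : ℕ) : 0 ≤ mlWeight b N j := by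
  rcases lt_or_ge N j with h | h
  · rw [mlWeight_eq_zero b h]
  · refine prod_nonneg fun i hi => ?_
    have : (i : ℝ) ≤ N := by exact_mod_cast (mem_range.mp hi).le.trans h
    have : 0 ≤ (N : ℝ) - i := by linarith
    positivity

/-- A bound uniform in `N`, needed to dominate the series in `mlPoly_tendsto`. -/
theorem mlWeight_le {b : ℝ} (hb : 0 ≤ b) {N : ℕ} (hN : 1 ≤ N) (j : ℕ) :
    mlWeight b N j ≤ (b + 2) ^ j := by
  rcases lt_or_ge N j with h | h
  · rw [mlWeight_eq_zero b h]; positivity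
  · have hN' : (1 : ℝ) ≤ N := by exact_mod_cast hN
    have key : ∀ i ∈ range j, (N + b + i) * (N - i) / (N : ℝ) ^ 2 ≤ b + 2 := by
      intro i hi
      have h1 : (i : ℝ) ≤ N := by exact_mod_cast (mem_range.mp hi).le.trans h
      have h0 : (0 : ℝ) ≤ i := i.cast_nonneg
      rw [div_le_iff₀ (by positivity)]
      have h2 : (N + b + i) * ((N : ℝ) - i) ≤ (N + b + i) * N :=
        mul_le_mul_of_nonneg_left (by linarith) (by positivity)
      have h3 : (N + b + i : ℝ) ≤ (b + 2) * N := by nlinarith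
      nlinarith
    calc mlWeight b N j ≤ ∏ _i ∈ range j, (b + 2) := by
          refine prod_le_prod (fun i hi => ?_) key
          have : (i : ℝ) ≤ N := by exact_mod_cast (mem_range.mp hi).le.trans h
          have : 0 ≤ (N : ℝ) - i := by linarith
          positivity
      _ = (b + 2) ^ j := by simp

theorem mlWeight_tendsto (b : ℝ) (j : ℕ) :
    Tendsto (fun N => mlWeight b N j) atTop (𝓝 1) := by
  have h : ∀ i : ℕ, Tendsto (fun N : ℕ => (N + b + i) * (N - i) / (N : ℝ) ^ 2) atTop (𝓝 1) := by
    intro i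
    have h1 : Tendsto (fun N : ℕ => (1 + (b + i) / (N : ℝ)) * (1 - i / (N : ℝ))) atTop
        (𝓝 ((1 + 0) * (1 - 0))) :=
      (tendsto_const_nhds.add (tendsto_const_div_atTop_nhds_zero_nat _)).mul
        (tendsto_const_nhds.sub (tendsto_const_div_atTop_nhds_zero_nat _))
    rw [add_zero, sub_zero, mul_one] at h1
    refine h1.congr' ?_
    filter_upwards [eventually_ge_atTop 1] with N hN
    have hN' : (N : ℝ) ≠ 0 := by positivity
    field_simp
    ring
  have h' := tendsto_finsetProd (range j) fun i _ => h i
  rw [prod_const_one] at h'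
  exact h'

theorem mlPoly_eval (b β : ℝ) (N : ℕ) (z : ℂ) :
    (mlPoly b β N).eval z
      = ∑ j ∈ range (N + 1), ((mlWeight b N j / Real.Gamma (2 * j + β) : ℝ) : ℂ) * z ^ j := by
  simp [mlPoly, eval_finsetSum]

/-- Explains the choice of weights: `risingCoeff (2j+b) (N-j) = Γ(N+b+j) / ((N-j)! Γ(2j+b))`, and
`mlWeight` is the remaining ratio of Gamma values and factorials, normalised by `N^(2j)`. -/
theorem mlWeight_div_Gamma {b : ℝ} (hb : 0 < b) {N j : ℕ} (hN : 1 ≤ N) (hj : j ≤ N) :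
    mlWeight b N j / Real.Gamma (2 * j + b)
      = N.factorial / Real.Gamma (N + b) * (risingCoeff (2 * j + b) (N - j) / (N ^ 2 : ℝ) ^ j) := by
  have hNp : (0 : ℝ) < N := by exact_mod_cast hN
  have hg1 : Real.Gamma (2 * j + b) ≠ 0 := (Real.Gamma_pos_of_pos (by positivity)).ne'
  have hg2 : Real.Gamma (N + b) ≠ 0 := (Real.Gamma_pos_of_pos (by positivity)).ne'
  have h1 := risingCoeff_mul_Gamma (r := 2 * j + b) (by positivity) (N - j)
  have h2 := prod_add_mul_Gamma (r := N + b) (by positivity) j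
  have h3 := prod_sub_mul_factorial hj
  have hf : ((N - j).factorial : ℝ) ≠ 0 := by positivity
  rw [show (2 * j + b + ((N - j : ℕ) : ℝ)) = N + b + j by rw [Nat.cast_sub hj]; ring, ← h2] at h1
  rw [mlWeight, prod_div_distrib, prod_mul_distrib, prod_const, card_range, ← h3]
  field_simp
  linear_combination -(∏ i ∈ range j, ((N : ℝ) - i)) * h1

theorem mlPoly_self_eval {b : ℝ} (hb : 0 < b) {N : ℕ} (hN : 1 ≤ N) (z : ℂ) :
    (mlPoly b b N).eval z
      = (N.factorial / Real.Gamma (N + b) : ℝ) * (risingPoly b N).eval (z / (N : ℂ) ^ 2) := by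
  have hdeg : (risingPoly b N).natDegree < N + 1 := by
    refine Nat.lt_succ_of_le (natDegree_le_iff_coeff_eq_zero.mpr fun j hj => ?_)
    rw [risingPoly_coeff, if_neg (by omega)]
  rw [mlPoly_eval, eval_eq_sum_range' hdeg, mul_sum]
  refine sum_congr rfl fun j hj => ?_
  have hj' : j ≤ N := Nat.lt_succ_iff.mp (mem_range.mp hj)
  rw [mlWeight_div_Gamma hb hN hj', risingPoly_coeff, if_pos hj']
  push_cast
  rw [div_pow]
  ring

theorem mlPoly_natDegree_ne_zero {b β : ℝ} (hb : 0 ≤ b) (hβ : 0 ≤ β) {N : ℕ} (hN : 1 ≤ N) :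
    (mlPoly b β N).natDegree ≠ 0 := by
  have hNp : (0 : ℝ) < N := by exact_mod_cast hN
  have h : (mlPoly b β N).coeff 1 ≠ 0 := by
    have hg : Real.Gamma (2 + β) ≠ 0 := (Real.Gamma_pos_of_pos (by positivity)).ne'
    have hw : mlWeight b N 1 ≠ 0 := by
      simp only [mlWeight, prod_range_one, Nat.cast_zero, add_zero, sub_zero]
      positivity
    rw [mlPoly, finsetSum_coeff]
    simp only [coeff_monomial]
    rw [sum_ite_eq', if_pos (mem_range.mpr (by omega)), Complex.ofReal_ne_zero]
    simpa using ⟨hw, hg⟩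
  have := le_natDegree_of_ne_zero h
  omega

theorem mlPoly_eval_ne_zero {b β : ℝ} (hb : 0 ≤ b) (hβ : 0 < β) (N : ℕ) {x : ℝ} (hx : 0 ≤ x) :
    (mlPoly b β N).eval (x : ℂ) ≠ 0 := by
  have e : (mlPoly b β N).eval (x : ℂ)
      = ((∑ j ∈ range (N + 1), mlWeight b N j / Real.Gamma (2 * j + β) * x ^ j : ℝ) : ℂ) := by
    rw [mlPoly_eval]; push_cast; rfl
  rw [e, Complex.ofReal_ne_zero]
  have hg : ∀ j : ℕ, 0 < Real.Gamma (2 * j + β) := fun j => Real.Gamma_pos_of_pos (by positivity)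
  refine (sum_pos' (fun j _ => ?_) ⟨0, by simp, ?_⟩).ne'
  · have := hg j
    have := mlWeight_nonneg hb N j
    positivity
  · simpa [mlWeight] using Real.Gamma_pos_of_pos hβ

/-- The operator `2 z d/dz + β` multiplies the coefficient of `z^j` by `2j + β`, and `Γ(2j+β+1) =
(2j+β) Γ(2j+β)`. The weights are untouched, which is why `b` and `β` are separate parameters. -/
theorem mlPoly_eval_sub_one (b : ℝ) {β : ℝ} (hβ : 0 ≤ β) (N : ℕ) (z : ℂ) :
    2 * z * (mlPoly b (β + 1) N).derivative.eval z + β * (mlPoly b (β + 1) N).eval z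
      = (mlPoly b β N).eval z := by
  rw [mlPoly_eval, mlPoly_eval, mlPoly, derivative_sum, eval_finsetSum, mul_sum, mul_sum,
    ← sum_add_distrib]
  refine sum_congr rfl fun j _ => ?_
  have hg : (mlWeight b N j / Real.Gamma (2 * j + β)) =
      mlWeight b N j / Real.Gamma (2 * j + (β + 1)) * (2 * j + β) := by
    -- When `j = β = 0`, both sides vanish: the left by the conventions `Γ 0 = 0` and `x / 0 = 0`,
    -- the right by its last factor.
    rcases eq_or_ne (2 * (j : ℝ) + β) 0 with h | h
    · rw [h]; simp
    · rw [← add_assoc, Real.Gamma_add_one h]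
      field_simp
  rw [hg, derivative_monomial, eval_monomial]
  rcases j with _ | j
  · simp; ring
  · push_cast
    simp only [pow_succ]
    ring

/-- All roots are negative reals. -/
def NegRooted (P : ℂ[X]) : Prop := ∀ z, P.eval z = 0 → z.im = 0 ∧ z.re < 0

theorem mlPoly_negRooted_of_im {b β : ℝ} (hb : 0 ≤ b) (hβ : 0 < β) {N : ℕ}
    (h : ∀ z, (mlPoly b β N).eval z = 0 → z.im = 0) : NegRooted (mlPoly b β N) := by
  refine fun z hz => ⟨h z hz, not_le.mp fun hre => ?_⟩
  have hzr : z = (z.re : ℂ) := Complex.ext rfl (by simp [h z hz])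
  rw [hzr] at hz
  exact mlPoly_eval_ne_zero hb hβ N hre hz

theorem mlPoly_self_negRooted {b : ℝ} (h2 : 2 ≤ b) (h3 : b ≤ 3) {N : ℕ} (hN : 1 ≤ N) :
    NegRooted (mlPoly b b N) := by
  have hb : 0 < b := by linarith
  have hNp : (0 : ℝ) < N := by exact_mod_cast hN
  refine mlPoly_negRooted_of_im hb.le hb fun z hz => ?_
  rw [mlPoly_self_eval hb hN] at hz
  have hc : ((N.factorial / Real.Gamma (N + b) : ℝ) : ℂ) ≠ 0 := by
    have := Real.Gamma_pos_of_pos (show 0 < N + b by positivity)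
    rw [Complex.ofReal_ne_zero]
    positivity
  have h := risingPoly_im_eq_zero h2 h3 N ((mul_eq_zero.mp hz).resolve_left hc)
  rw [show (z / (N : ℂ) ^ 2) = z / ((N ^ 2 : ℝ) : ℂ) by push_cast; rfl, Complex.div_ofReal_im,
    div_eq_zero_iff] at h
  exact h.resolve_right (by positivity)

theorem mlPoly_im_eq_zero {b β : ℝ} (hb : 0 ≤ b) (hβ : 0 ≤ β) {N : ℕ} (hN : 1 ≤ N)
    (h : NegRooted (mlPoly b (β + 1) N)) {z : ℂ} (hz : (mlPoly b β N).eval z = 0) :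
    z.im = 0 := by
  rw [← mlPoly_eval_sub_one b hβ] at hz
  exact im_eq_zero_of_eval_two_mul_derivative_add
    (mlPoly_natDegree_ne_zero hb (by linarith) hN) h β hz

/-- Take `b = β`, `β + 1` or `β + 2` so that `b ∈ [2, 3]`, then descend from `b` to `β` in unit
steps. Between two steps, positivity of the coefficients turns real roots into negative ones. -/
theorem exists_mlPoly_im_eq_zero {β : ℝ} (hβ : 0 ≤ β) (h3 : β ≤ 3) : ∃ b : ℝ, 0 ≤ b ∧
    ∀ N : ℕ, 1 ≤ N → ∀ z, (mlPoly b β N).eval z = 0 → z.im = 0 := by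
  rcases le_or_gt 2 β with h2 | h2
  · exact ⟨β, hβ, fun N hN z hz => (mlPoly_self_negRooted h2 h3 hN z hz).1⟩
  rcases le_or_gt 1 β with h1 | h1
  · have hb : 0 ≤ β + 1 := by linarith
    exact ⟨β + 1, hb, fun N hN z hz => mlPoly_im_eq_zero hb hβ hN
      (mlPoly_self_negRooted (by linarith) (by linarith) hN) hz⟩
  · have hb : 0 ≤ β + 1 + 1 := by linarith
    have hb1 : 0 < β + 1 := by linarith
    refine ⟨β + 1 + 1, hb, fun N hN z hz => mlPoly_im_eq_zero hb hβ hN ?_ hz⟩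
    refine mlPoly_negRooted_of_im hb hb1 fun y hy => mlPoly_im_eq_zero hb hb1.le hN
      (mlPoly_self_negRooted (by linarith) (by linarith) hN) hy

theorem summable_pow_div_Gamma {β : ℝ} (hβ : 0 ≤ β) (x : ℝ) :
    Summable fun j : ℕ => x ^ j / Real.Gamma (2 * j + β) := by
  rcases eq_or_ne x 0 with rfl | hx
  · refine summable_of_ne_finset_zero (s := {0}) fun j hj => ?_
    rw [zero_pow (by simpa using hj), zero_div]
  have hg : ∀ j : ℕ, 1 ≤ j → 0 < Real.Gamma (2 * j + β) := fun j hj => by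
    have : (1 : ℝ) ≤ j := by exact_mod_cast hj
    exact Real.Gamma_pos_of_pos (by positivity)
  have hlim : Tendsto (fun j : ℕ => |x| / ((2 * j + β + 1) * (2 * j + β))) atTop (𝓝 0) := by
    refine Tendsto.div_atTop tendsto_const_nhds ?_
    have h1 : Tendsto (fun j : ℕ => 2 * (j : ℝ)) atTop atTop :=
      tendsto_natCast_atTop_atTop.const_mul_atTop two_pos
    exact (tendsto_atTop_add_const_right _ _ (tendsto_atTop_add_const_right _ _ h1)).atTop_mul_atTop₀
      (tendsto_atTop_add_const_right _ _ h1)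
  refine summable_of_ratio_test_tendsto_lt_one zero_lt_one ?_ (hlim.congr' ?_)
  · filter_upwards [eventually_ge_atTop 1] with j hj
    exact div_ne_zero (pow_ne_zero _ hx) (hg j hj).ne'
  · filter_upwards [eventually_ge_atTop 1] with j hj
    have hj' : (1 : ℝ) ≤ j := by exact_mod_cast hj
    have h0 : (2 * j + β : ℝ) ≠ 0 := by positivity
    have h1 : (2 * j + β + 1 : ℝ) ≠ 0 := by positivity
    have e : Real.Gamma (2 * ((j + 1 : ℕ) : ℝ) + β)
        = (2 * j + β + 1) * ((2 * j + β) * Real.Gamma (2 * j + β)) := by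
      rw [← Real.Gamma_add_one h0, ← Real.Gamma_add_one h1]
      congr 1
      push_cast
      ring
    have hgj := hg j hj
    have hpos : 0 < (2 * j + β + 1) * ((2 * j + β) * Real.Gamma (2 * j + β)) := by positivity
    rw [e, Real.norm_eq_abs, Real.norm_eq_abs, abs_div, abs_div, abs_of_pos hpos, abs_of_pos hgj,
      abs_pow, abs_pow, pow_succ]
    have : |x| ≠ 0 := abs_ne_zero.mpr hx
    field_simp

theorem mlPoly_tendsto {b β : ℝ} (hb : 0 ≤ b) (hβ : 0 ≤ β) (z : ℂ) :
    Tendsto (fun N => (mlPoly b β N).eval z) atTop (𝓝 (mittagLeffler 2 β z)) := by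
  have hN : ∀ N, (mlPoly b β N).eval z
      = ∑' j : ℕ, ((mlWeight b N j / Real.Gamma (2 * j + β) : ℝ) : ℂ) * z ^ j := by
    intro N
    rw [mlPoly_eval, tsum_eq_sum]
    intro j hj
    rw [mlWeight_eq_zero b (by simpa using hj)]
    simp
  simp only [hN, mittagLeffler]
  refine tendsto_tsum_of_dominated_convergence
    (bound := fun j : ℕ => |((b + 2) * ‖z‖) ^ j / Real.Gamma (2 * j + β)|)
    (summable_pow_div_Gamma hβ _).abs (fun j => ?_) ?_
  · have h := (mlWeight_tendsto b j).div_const (Real.Gamma (2 * j + β))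
    have h' := ((Complex.continuous_ofReal.tendsto _).comp h).mul_const (z ^ j)
    rw [show z ^ j / (Real.Gamma (2 * j + β) : ℂ)
      = ((1 / Real.Gamma (2 * j + β) : ℝ) : ℂ) * z ^ j by push_cast; ring]
    exact h'
  · filter_upwards [eventually_ge_atTop 1] with N hN j
    rw [norm_mul, Complex.norm_real, norm_pow, mul_pow, Real.norm_eq_abs, abs_div, abs_div, abs_mul,
      abs_pow, abs_pow, abs_norm, abs_of_nonneg (mlWeight_nonneg hb N j),
      abs_of_nonneg (show 0 ≤ b + 2 by linarith), div_mul_eq_mul_div]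
    gcongr
    exact mlWeight_le hb hN j

theorem mittagLefflerGlobalGE_of_le_three {β : ℝ} (hβ : 0 ≤ β) (h3 : β ≤ 3) :
    MittagLefflerGlobalGE 2 β := by
  intro z
  obtain ⟨b, hb, h⟩ := exists_mlPoly_im_eq_zero hβ h3
  have hle : ‖mittagLeffler 2 β (z.re : ℂ)‖ ≤ ‖mittagLeffler 2 β z‖ := by
    refine le_of_tendsto_of_tendsto (mlPoly_tendsto hb hβ _).norm (mlPoly_tendsto hb hβ z).norm ?_
    filter_upwards [eventually_ge_atTop 1] with N hN
    exact norm_eval_re_le_norm_eval (h N hN) z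
  rw [mittagLeffler_ofReal, Complex.norm_real] at hle
  exact (le_abs_self _).trans hle

end Approximation

section Positivity

open MeasureTheory Set

/-! ### Positivity on the real line -/

theorem integrableOn_beta {a b : ℝ} (ha : 0 < a) (hb : 0 < b) :
    IntegrableOn (fun t : ℝ => t ^ (a - 1) * (1 - t) ^ (b - 1)) (Ioo 0 1) ∧
      ∫ t in Ioo (0 : ℝ) 1, t ^ (a - 1) * (1 - t) ^ (b - 1)
        = Real.Gamma a * Real.Gamma b / Real.Gamma (a + b) := by
  have hc := Complex.betaIntegral_convergent (u := a) (v := b) (by simpa) (by simpa)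
  rw [intervalIntegrable_iff_integrableOn_Ioo_of_le zero_le_one] at hc
  have hcongr : ∀ t ∈ Ioo (0 : ℝ) 1, (t : ℂ) ^ ((a : ℂ) - 1) * (1 - (t : ℂ)) ^ ((b : ℂ) - 1)
      = ((t ^ (a - 1) * (1 - t) ^ (b - 1) : ℝ) : ℂ) := by
    intro t ht
    rw [Complex.ofReal_mul, Complex.ofReal_cpow ht.1.le, Complex.ofReal_cpow (by linarith [ht.2])]
    push_cast
    rfl
  have hi : IntegrableOn (fun t : ℝ => ((t ^ (a - 1) * (1 - t) ^ (b - 1) : ℝ) : ℂ)) (Ioo 0 1) :=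
    hc.congr_fun hcongr measurableSet_Ioo
  refine ⟨by rw [IntegrableOn]; simpa using hi.re, ?_⟩
  have hB := Complex.betaIntegral_eq_Gamma_mul_div a b (by simpa) (by simpa)
  rw [Complex.betaIntegral, intervalIntegral.integral_of_le zero_le_one,
    integral_Ioc_eq_integral_Ioo, setIntegral_congr_fun measurableSet_Ioo hcongr,
    integral_complex_ofReal, ← Complex.ofReal_add, Complex.Gamma_ofReal, Complex.Gamma_ofReal,
    Complex.Gamma_ofReal] at hB
  exact_mod_cast hB

theorem hasSum_one_sub_cos {x : ℝ} (hx : x ≠ 0) (t : ℝ) :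
    HasSum (fun k : ℕ => (-x ^ 2) ^ k / (2 * k + 2).factorial * t ^ (2 * k + 2))
      ((1 - Real.cos (x * t)) / x ^ 2) := by
  have h := ((hasSum_nat_add_iff' 1).mpr (Real.hasSum_cos (x * t))).mul_left (-1 / x ^ 2)
  have e : (1 - Real.cos (x * t)) / x ^ 2 = -1 / x ^ 2 * (Real.cos (x * t) -
      ∑ i ∈ Finset.range 1, (-1) ^ i * (x * t) ^ (2 * i) / (2 * i).factorial) := by
    simp
    field_simp
    ring
  rw [e]
  refine Eq.mpr (congrArg (HasSum · _) (funext fun k => ?_)) h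
  rw [show 2 * (k + 1) = 2 * k + 2 by ring, mul_pow, neg_pow, ← pow_mul, pow_succ (-1 : ℝ),
    pow_add x]
  field_simp

/-- Integrate the power series of `(1 - cos xt) / x²` term by term against `(1 - t)^(β-4)`, which is
integrable since `β > 3`. The beta integral `B(2k+3, β-3)` replaces `(2k+2)!` by `Γ(2k+β) / Γ(β-3)`
in the denominator. -/
theorem integral_one_sub_cos {β : ℝ} (hβ : 3 < β) {x : ℝ} (hx : x ≠ 0) :
    Real.Gamma (β - 3) * mittagLefflerReal 2 β (-x ^ 2)
      = ∫ t in Ioo (0 : ℝ) 1, (1 - Real.cos (x * t)) / x ^ 2 * (1 - t) ^ (β - 3 - 1) := by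
  set F : ℕ → ℝ → ℝ := fun k t => (-x ^ 2) ^ k / (2 * k + 2).factorial *
    (t ^ ((2 * k + 3 : ℝ) - 1) * (1 - t) ^ (β - 3 - 1)) with hF
  have hb : 0 < β - 3 := by linarith
  have hi : ∀ k, IntegrableOn (F k) (Ioo 0 1) := fun k =>
    (integrableOn_beta (a := 2 * k + 3) (by positivity) hb).1.const_mul _
  have hfac : ∀ k : ℕ, Real.Gamma (2 * k + 3) = (2 * k + 2).factorial := fun k => by
    rw [← Real.Gamma_nat_eq_factorial]
    congr 1
    push_cast
    ring
  -- A free `c` serves both the terms, `c = (-x²)^k`, and their norms, `c = (x²)^k`.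
  have hval : ∀ (c : ℝ) (k : ℕ), ∫ t in Ioo (0 : ℝ) 1, c / (2 * k + 2).factorial *
      (t ^ ((2 * k + 3 : ℝ) - 1) * (1 - t) ^ (β - 3 - 1))
      = Real.Gamma (β - 3) * (c / Real.Gamma (2 * k + β)) := fun c k => by
    have := (2 * k + 2).factorial_pos
    rw [integral_const_mul, (integrableOn_beta (a := 2 * k + 3) (by positivity) hb).2, hfac,
      show (2 * (k : ℝ) + 3 + (β - 3)) = 2 * k + β by ring]
    field_simp
  have hnorm : ∀ k, ∫ t in Ioo (0 : ℝ) 1, ‖F k t‖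
      = Real.Gamma (β - 3) * ((x ^ 2) ^ k / Real.Gamma (2 * k + β)) := fun k => by
    rw [← hval]
    refine setIntegral_congr_fun measurableSet_Ioo fun t ht => ?_
    have h1 : 0 ≤ 1 - t := by linarith [ht.2]
    have h2 : 0 ≤ t := ht.1.le
    simp only [hF]
    rw [norm_mul, norm_div, norm_pow, norm_neg, Real.norm_of_nonneg (by positivity : 0 ≤ x ^ 2),
      Real.norm_of_nonneg (Nat.cast_nonneg _), Real.norm_of_nonneg (by positivity)]
  have hs := hasSum_integral_of_summable_integral_norm hi (by
    simp only [hnorm]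
    exact (summable_pow_div_Gamma (by linarith) _).mul_left _)
  simp only [hF, hval] at hs
  have hs' := ((summable_pow_div_Gamma (β := β) (by linarith) (-x ^ 2)).hasSum).mul_left
    (Real.Gamma (β - 3))
  rw [mittagLefflerReal, hs'.unique hs]
  refine setIntegral_congr_fun measurableSet_Ioo fun t ht => ?_
  have h := (hasSum_one_sub_cos hx t).mul_right ((1 - t) ^ (β - 3 - 1))
  rw [← h.tsum_eq]
  refine tsum_congr fun k => ?_
  rw [← mul_assoc, show (2 * k + 3 : ℝ) - 1 = ((2 * k + 2 : ℕ) : ℝ) by push_cast; ring,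
    Real.rpow_natCast]

theorem mittagLefflerReal_pos_of_nonneg {β : ℝ} (hβ : 0 < β) {x : ℝ} (hx : 0 ≤ x) :
    0 < mittagLefflerReal 2 β x := by
  have hg : ∀ j : ℕ, 0 < Real.Gamma (2 * j + β) := fun j => Real.Gamma_pos_of_pos (by positivity)
  refine (summable_pow_div_Gamma hβ.le x).tsum_pos (fun j => ?_) 0 ?_
  · have := hg j
    positivity
  · simpa using Real.Gamma_pos_of_pos hβ

theorem mittagLefflerReal_pos {β : ℝ} (hβ : 3 < β) (x : ℝ) : 0 < mittagLefflerReal 2 β x := by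
  rcases le_or_gt 0 x with hx | hx
  · exact mittagLefflerReal_pos_of_nonneg (by linarith) hx
  obtain ⟨y, hy, rfl⟩ : ∃ y : ℝ, 0 < y ∧ x = -y ^ 2 :=
    ⟨√(-x), Real.sqrt_pos.mpr (by linarith), by rw [Real.sq_sqrt (by linarith)]; ring⟩
  have hb : 0 < β - 3 := by linarith
  refine pos_of_mul_pos_right ?_ (Real.Gamma_pos_of_pos hb).le
  rw [integral_one_sub_cos hβ hy.ne']
  have hnn : ∀ t ∈ Ioo (0 : ℝ) 1,
      0 ≤ (1 - Real.cos (y * t)) / y ^ 2 * (1 - t) ^ (β - 3 - 1) := fun t ht => by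
    have h1 : 0 ≤ 1 - t := by linarith [ht.2]
    have h2 : 0 ≤ 1 - Real.cos (y * t) := sub_nonneg.mpr (Real.cos_le_one _)
    positivity
  have hint : IntegrableOn (fun t : ℝ => (1 - Real.cos (y * t)) / y ^ 2 * (1 - t) ^ (β - 3 - 1))
      (Ioo 0 1) := by
    have h0 : IntegrableOn (fun t : ℝ => (1 - t) ^ (β - 3 - 1)) (Ioo 0 1) := by
      simpa using (integrableOn_beta one_pos hb).1
    refine h0.bdd_mul (c := 2 / y ^ 2) (by fun_prop) (ae_of_all _ fun t => ?_)
    rw [norm_div, Real.norm_of_nonneg (by positivity : 0 ≤ y ^ 2), Real.norm_of_nonneg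
      (sub_nonneg.mpr (Real.cos_le_one _))]
    gcongr
    linarith [Real.neg_one_le_cos (y * t)]
  rw [setIntegral_pos_iff_support_of_nonneg_ae
    ((ae_restrict_iff' measurableSet_Ioo).mpr (ae_of_all _ hnn)) hint]
  -- On this initial interval `0 < y t < 1 < 2π`, so the cosine differs from `1` and the integrand
  -- is nonzero.
  have hm : 0 < min 1 (1 / y) := by positivity
  refine lt_of_lt_of_le (by simpa using hm) (measure_mono (s := Ioo 0 (min 1 (1 / y))) ?_)
  intro t ht
  have ht1 : t < 1 := ht.2.trans_le (min_le_left _ _)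
  have hty : y * t < 1 := by
    have := ht.2.trans_le (min_le_right _ _)
    rwa [lt_div_iff₀ hy, mul_comm] at this
  have hty0 : 0 < y * t := mul_pos hy ht.1
  refine ⟨?_, ht.1, ht1⟩
  rw [Function.mem_support]
  have hcos : Real.cos (y * t) ≠ 1 := by
    rw [Ne, Real.cos_eq_one_iff_of_lt_of_lt (by linarith [Real.pi_gt_three])
      (by linarith [Real.pi_gt_three])]
    exact hty0.ne'
  have h1 : 0 < 1 - t := by linarith
  exact mul_ne_zero (div_ne_zero (sub_ne_zero.mpr hcos.symm) (by positivity))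
    (Real.rpow_pos_of_pos h1 _).ne'

end Positivity

section Zeros

open Metric

/-! ### Existence of complex zeros -/

/-- An entire function of growth at most `exp √|z|` without zeros is constant. -/
theorem eq_const_of_norm_le_exp_sqrt {f : ℂ → ℂ} (hf : Differentiable ℂ f) (h0 : ∀ z, f z ≠ 0)
    (hb : ∀ z, ‖f z‖ ≤ Real.exp √‖z‖) (z : ℂ) : f z = f 0 := by
  have hq : Differentiable ℂ fun z => deriv f z / f z := (hf.deriv).div hf h0
  -- A primitive of `f'/f` is a global logarithm, so `f = f(0) exp g` and the growth bound becomes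
  -- `Re g ≤ √|z| + c`.
  obtain ⟨g, hg0, hg⟩ : ∃ g : ℂ → ℂ, g 0 = 0 ∧ ∀ z, HasDerivAt g (deriv f z / f z) z := by
    obtain ⟨g, hg⟩ := hq.isExactOn_univ
    refine ⟨fun z => g z - g 0, sub_self _, fun z => (hg z (Set.mem_univ z)).sub_const _⟩
  have hgd : Differentiable ℂ g := fun z => (hg z).differentiableAt
  have hfg : ∀ z, f z = f 0 * Complex.exp (g z) := by
    intro z
    have hd : ∀ w, HasDerivAt (fun w => f w * Complex.exp (-g w)) 0 w := by
      intro w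
      have h := (hf w).hasDerivAt.mul ((hg w).neg.cexp)
      refine h.congr_deriv ?_
      have := h0 w
      field_simp
      ring
    have h := is_const_of_deriv_eq_zero (fun w => (hd w).differentiableAt)
      (fun w => (hd w).deriv) z 0
    simp only [hg0, neg_zero, Complex.exp_zero, mul_one] at h
    rw [← h, mul_assoc, ← Complex.exp_add, neg_add_cancel, Complex.exp_zero, mul_one]
  have hf0 : 0 < ‖f 0‖ := norm_pos_iff.mpr (h0 0)
  set c : ℝ := |Real.log ‖f 0‖| + 1 with hc
  have hc1 : 1 ≤ c := by rw [hc]; linarith [abs_nonneg (Real.log ‖f 0‖)]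
  have hre : ∀ z, (g z).re ≤ √‖z‖ + c := by
    intro z
    have h := hb z
    rw [hfg z, norm_mul, Complex.norm_exp, ← Real.exp_log hf0, ← Real.exp_add, Real.exp_le_exp] at h
    linarith [neg_abs_le (Real.log ‖f 0‖)]
  suffices hgz : g z = 0 by rw [hfg z, hgz, Complex.exp_zero, mul_one]
  by_contra hne
  have hgpos : 0 < ‖g z‖ := norm_pos_iff.mpr hne
  set a := ‖z‖ with ha
  have ha0 : 0 ≤ a := norm_nonneg z
  -- Borel–Carathéodory on the disc of radius `S²`, where `Re g ≤ S + c`, gives `‖g z‖ ≤ 2 (S + c) a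
  -- / (S² - a) ≤ 4 (1 + c) a / S`. The last summand of `S` makes this impossible; the others ensure
  -- `S ≥ 1` and `S² - a ≥ S² / 2`.
  set S : ℝ := 1 + 2 * a + 4 * (1 + c) * a / ‖g z‖ with hS
  have hS0 : 0 ≤ 4 * (1 + c) * a / ‖g z‖ := by positivity
  have hS1 : 1 + 2 * a ≤ S := by linarith
  have hSa : S ^ 2 / 2 ≤ S ^ 2 - a := by nlinarith
  have hR : 0 < S ^ 2 := by nlinarith
  have hBC := Complex.borelCaratheodory_zero (f := g) (M := S + c) (R := S ^ 2) (z := z)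
    (by linarith) hgd.differentiableOn (fun w hw => ?_) hR
    (by rw [mem_ball_zero_iff]; nlinarith) hg0
  · have h1 : ‖g z‖ * (S ^ 2 / 2) ≤ 2 * (S + c) * a := by
      rw [le_div_iff₀ (by nlinarith)] at hBC
      exact (mul_le_mul_of_nonneg_left hSa hgpos.le).trans hBC
    have h2 : 2 * (S + c) * a ≤ 2 * ((1 + c) * S) * a := by
      gcongr
      nlinarith
    have h3 : ‖g z‖ * S ≤ 4 * (1 + c) * a := by
      have hSpos : 0 < S := by linarith
      have : (‖g z‖ * S) * S ≤ (4 * (1 + c) * a) * S := by nlinarith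
      exact le_of_mul_le_mul_right this hSpos
    have h4 : ‖g z‖ * S = ‖g z‖ * (1 + 2 * a) + 4 * (1 + c) * a := by
      rw [hS]
      field_simp
    have h5 : 0 < ‖g z‖ * (1 + 2 * a) := by positivity
    linarith
  · have hw' : ‖w‖ < S ^ 2 := mem_ball_zero_iff.mp hw
    have : √‖w‖ ≤ S := Real.sqrt_le_iff.mpr ⟨by linarith, hw'.le⟩
    exact (hre w).trans (by linarith)

theorem norm_pow_div_Gamma {β : ℝ} (hβ : 0 < β) (z : ℂ) (k : ℕ) :
    ‖z ^ k / (Real.Gamma (2 * k + β) : ℂ)‖ = ‖z‖ ^ k / Real.Gamma (2 * k + β) := by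
  have : 0 < Real.Gamma (2 * k + β) := Real.Gamma_pos_of_pos (by positivity)
  rw [norm_div, norm_pow, Complex.norm_real, Real.norm_of_nonneg this.le]

theorem mittagLeffler_differentiable {β : ℝ} (hβ : 0 < β) :
    Differentiable ℂ (mittagLeffler 2 β) := by
  intro z
  have h : DifferentiableOn ℂ (mittagLeffler 2 β) (ball 0 (‖z‖ + 1)) := by
    refine Complex.differentiableOn_tsum_of_summable_norm
      (summable_pow_div_Gamma hβ.le (‖z‖ + 1)) (fun k => by fun_prop) isOpen_ball fun k w hw => ?_
    have := Real.Gamma_pos_of_pos (show 0 < 2 * k + β by positivity)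
    rw [norm_pow_div_Gamma hβ]
    gcongr
    exact (mem_ball_zero_iff.mp hw).le
  exact h.differentiableAt (isOpen_ball.mem_nhds (by simp))

/-- Since `Γ(2k+β) ≥ Γ(2k+3) ≥ (2k)!`, the series of norms is dominated by that of `cosh √|z|`. -/
theorem norm_mittagLeffler_le {β : ℝ} (hβ : 3 ≤ β) (z : ℂ) :
    ‖mittagLeffler 2 β z‖ ≤ Real.exp √‖z‖ := by
  have hβ0 : 0 < β := by linarith
  have hs := summable_pow_div_Gamma hβ0.le ‖z‖
  have h1 : ‖mittagLeffler 2 β z‖ ≤ ∑' k : ℕ, ‖z‖ ^ k / Real.Gamma (2 * k + β) := by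
    simp only [← norm_pow_div_Gamma hβ0 z] at hs ⊢
    exact norm_tsum_le_tsum_norm hs
  have hcosh := Real.hasSum_cosh √‖z‖
  have h2 : ∑' k : ℕ, ‖z‖ ^ k / Real.Gamma (2 * k + β) ≤ Real.cosh √‖z‖ := by
    rw [← hcosh.tsum_eq]
    refine hs.tsum_le_tsum (fun k => ?_) hcosh.summable
    rw [pow_mul, Real.sq_sqrt (norm_nonneg z)]
    have hG : ((2 * k).factorial : ℝ) ≤ Real.Gamma (2 * k + β) := by
      have e : Real.Gamma (2 * k + 3) = (2 * k + 2).factorial := by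
        rw [← Real.Gamma_nat_eq_factorial]
        congr 1
        push_cast
        ring
      calc ((2 * k).factorial : ℝ) ≤ (2 * k + 2).factorial := by
            exact_mod_cast Nat.factorial_le (by omega)
        _ = Real.Gamma (2 * k + 3) := e.symm
        _ ≤ Real.Gamma (2 * k + β) := by
            have hk : (0 : ℝ) ≤ k := k.cast_nonneg
            exact Real.Gamma_strictMonoOn_Ici.monotoneOn (by simp only [Set.mem_Ici]; linarith)
              (by simp only [Set.mem_Ici]; linarith) (by linarith)
    gcongr
  refine h1.trans (h2.trans ?_)
  rw [Real.cosh_eq]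
  have : Real.exp (-√‖z‖) ≤ Real.exp √‖z‖ :=
    Real.exp_le_exp.mpr (by linarith [Real.sqrt_nonneg ‖z‖])
  linarith

/-- Rules out the constant case left open by `eq_const_of_norm_le_exp_sqrt`. -/
theorem mittagLefflerReal_zero_lt_one {β : ℝ} (hβ : 0 < β) :
    mittagLefflerReal 2 β 0 < mittagLefflerReal 2 β 1 := by
  have hg : ∀ j : ℕ, 0 < Real.Gamma (2 * j + β) := fun j => Real.Gamma_pos_of_pos (by positivity)
  refine (summable_pow_div_Gamma hβ.le 0).tsum_lt_tsum (i := 1) (fun k => ?_) ?_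
    (summable_pow_div_Gamma hβ.le 1)
  · have := hg k
    gcongr
    exact zero_le_one
  · have := hg 1
    simpa using this

theorem exists_mittagLeffler_eq_zero {β : ℝ} (hβ : 3 ≤ β) : ∃ z : ℂ, mittagLeffler 2 β z = 0 := by
  by_contra! h
  have hβ0 : 0 < β := by linarith
  have h1 := eq_const_of_norm_le_exp_sqrt (mittagLeffler_differentiable hβ0) h
    (norm_mittagLeffler_le hβ) ((1 : ℝ) : ℂ)
  rw [← Complex.ofReal_zero, mittagLeffler_ofReal, mittagLeffler_ofReal, Complex.ofReal_inj] at h1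
  exact (mittagLefflerReal_zero_lt_one hβ0).ne' h1

theorem not_mittagLefflerGlobalGE {β : ℝ} (hβ : 3 < β) : ¬ MittagLefflerGlobalGE 2 β := by
  intro h
  obtain ⟨z, hz⟩ := exists_mittagLeffler_eq_zero hβ.le
  have h1 := h z
  rw [hz, norm_zero] at h1
  exact absurd h1 (not_le.mpr (mittagLefflerReal_pos hβ z.re))

theorem mittagLeffler_zero_im_ne_zero {β : ℝ} (hβ : 3 < β) {z : ℂ}
    (hz : mittagLeffler 2 β z = 0) : z.im ≠ 0 := by
  intro him
  have hzr : z = (z.re : ℂ) := Complex.ext rfl (by simp [him])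
  rw [hzr, mittagLeffler_ofReal, Complex.ofReal_eq_zero] at hz
  exact (mittagLefflerReal_pos hβ z.re).ne' hz

end Zeros

theorem propositionE24 :
    (∀ β : ℝ, 4 ≤ β →
      (∀ x : ℝ, 0 < mittagLefflerReal 2 β x) ∧
      (∃ z : ℂ, mittagLeffler 2 β z = 0) ∧
      (∀ z : ℂ, mittagLeffler 2 β z = 0 → z.im ≠ 0) ∧
      ¬ MittagLefflerGlobalGE 2 β) ∧
    (∀ β : ℝ, 3 < β → β < 4 →
      {x : ℝ | x < 0 ∧ mittagLefflerReal 2 β x = 0}.Finite ∧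
      ¬ MittagLefflerGlobalGE 2 β) ∧
    (∀ β : ℝ, 0 ≤ β → (MittagLefflerGlobalGE 2 β ↔ β ≤ 3)) := by
  refine ⟨fun β h4 => ?_, fun β h3 _ => ⟨?_, not_mittagLefflerGlobalGE h3⟩, fun β h0 => ⟨fun h => ?_,
    mittagLefflerGlobalGE_of_le_three h0⟩⟩
  · have h3 : 3 < β := by linarith
    exact ⟨mittagLefflerReal_pos h3, exists_mittagLeffler_eq_zero h3.le,
      fun z => mittagLeffler_zero_im_ne_zero h3, not_mittagLefflerGlobalGE h3⟩
  -- Positivity on the real line holds for all `β > 3`, so the set of negative zeros is in fact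
  -- empty.
  · refine Set.finite_empty.subset fun x hx => ?_
    exact absurd hx.2 (mittagLefflerReal_pos h3 x).ne'
  · exact not_lt.mp fun h3 => not_mittagLefflerGlobalGE h3 h
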